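/- All subcategories are full and closed under homeomorphism. Let $\mathbf{A}$ be an epireflective subcategory of the category $\mathbf{Top}$ of all topological spaces (every space $X$ has a reflection $X\to RX$ in $\mathbf{A}$, and every such reflection map is an epimorphism in $\mathbf{Top}$), and suppose that the two-point indiscrete space does not belong to $\mathbf{A}$. Let $\mathbf{B}\subseteq\mathbf{A}$ be an HAD-class in $\mathbf{A}$, i.e. $\mathbf{B}$ is closed under subspaces, closed under topological sums, and divisible in $\mathbf{A}$: whenever $q\colon X\to Y$ is a quotient map with $X\in\mathbf{B}$ and $Y\in\mathbf{A}$, then $Y\in\mathbf{B}$. If $\mathbf{B}$ contains at least one prime space, i.e. a space with exactly one accumulation point (non-isolated point), then the coreflective hull $\mathrm{CH}(\mathbf{B})$ of $\mathbf{B}$ in $\mathbf{Top}$ (the smallest coreflective subcategory of $\mathbf{Top}$ containing $\mathbf{B}$) is hereditary, i.e. closed under subspaces. -/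

import Mathlib

open CategoryTheory Topology

universe u

/-! A class of topological spaces, or a full isomorphism-closed subcategory of the category of
all topological spaces, is an `ObjectProperty TopCat.{u}` closed under isomorphisms. -/

/-- `A` is an epireflective subcategory: it is full and isomorphism-closed, every space has a
reflection in `A`, and all reflection arrows are epimorphisms of topological spaces. -/
def IsEpireflective (A : ObjectProperty TopCat.{u}) : Prop :=
  A.IsClosedUnderIsomorphisms ∧
    ∃ r : Reflective A.ι, ∀ X : TopCat.{u}, Epi (r.adj.unit.app X)

/-- `C` is a coreflective subcategory of the category of all topological spaces (full and
isomorphism-closed). -/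
def IsCoreflectiveSubcat (C : ObjectProperty TopCat.{u}) : Prop :=
  C.IsClosedUnderIsomorphisms ∧ Nonempty (Coreflective C.ι)

/-- The coreflective hull of `B`: the intersection of all coreflective subcategories
containing `B`. -/
def coreflectiveHull (B : ObjectProperty TopCat.{u}) : ObjectProperty TopCat.{u} :=
  fun X => ∀ C : ObjectProperty TopCat.{u}, IsCoreflectiveSubcat C → B ≤ C → C X

/-- Closed under the formation of subspaces. -/
def IsHereditary (B : ObjectProperty TopCat.{u}) : Prop :=
  ∀ X : TopCat.{u}, B X → ∀ S : Set X, B (TopCat.of S)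

/-- Closed under the formation of topological sums (of set-indexed families). -/
def IsAdditive (B : ObjectProperty TopCat.{u}) : Prop :=
  ∀ (ι : Type u) (X : ι → TopCat.{u}), (∀ i, B (X i)) → B (TopCat.of (Σ i, X i))

/-- Closed under those quotient spaces that belong to `A`. -/
def IsDivisibleIn (A B : ObjectProperty TopCat.{u}) : Prop :=
  ∀ (X Y : TopCat.{u}) (q : X → Y), IsQuotientMap q → B X → A Y → B Y

/-- `B` is a hereditary, additive and divisible class in `A`. -/
structure IsHADClass (A B : ObjectProperty TopCat.{u}) : Prop where
  isoClosed : B.IsClosedUnderIsomorphisms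
  le : B ≤ A
  hereditary : IsHereditary B
  additive : IsAdditive B
  divisible : IsDivisibleIn A B

/-- A prime space: a topological space with exactly one accumulation point. -/
def IsPrimeSpace (X : Type u) [TopologicalSpace X] : Prop :=
  ∃! a : X, AccPt a (Filter.principal Set.univ)

/-- The two-point indiscrete space. -/
def twoPointIndiscrete : TopCat.{u} := TopCat.trivial.obj (ULift.{u} Bool)

/-! The hull consists of the spaces whose topology is final for maps from `B`. Let `Y` be such a
space, `S ⊆ Y`, and let `U ⊆ S` have open preimages under all maps from `B` to `S`. Put `M = S \ U`.
It suffices that `primeClosure B M` is closed in `Y` and meets `S` exactly in `M`. The trace is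
easy: a prime space in `B` converging from `M` to a point of `U` maps into `S`, and the preimage of
`U` would be its accumulation point alone, hence not open.

Closedness is tested along `g : Z → Y` with `Z` in `B`. At each point of `Z` sent into the prime
closure, glue on a prime space witnessing this. If `z` is a limit of such points, then `z` together
with all the new points is a prime subspace of the glued space, and it witnesses that `g z` is in
the prime closure.

The glued space is a quotient of a sum of members of `B`, so divisibility puts it in `B` once it is
in `A`. That is where `A` being epireflective without the indiscrete pair enters. -/

/-! ### Membership in an epireflective subcategory -/

/-- A reflection arrow of an epireflective subcategory, in elementary terms. -/
theorem IsEpireflective.exists_reflection {A : ObjectProperty TopCat.{u}} (hA : IsEpireflective A)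
    (Y : TopCat.{u}) :
    ∃ (R : TopCat.{u}) (r : Y → R), A R ∧ Continuous r ∧ Function.Surjective r ∧
      ∀ (Z : TopCat.{u}) (f : Y → Z), A Z → Continuous f →
        ∃ f' : R → Z, Continuous f' ∧ ∀ y, f' (r y) = f y := by
  obtain ⟨-, r, hr⟩ := hA
  refine ⟨(r.L.obj Y).obj, r.adj.unit.app Y, (r.L.obj Y).property,
    (r.adj.unit.app Y).hom.continuous, (TopCat.epi_iff_surjective _).1 (hr Y), ?_⟩
  intro Z f hZ hf
  let g : Y ⟶ A.ι.obj ⟨Z, hZ⟩ := TopCat.ofHom ⟨f, hf⟩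
  let f' := ((r.adj.homEquiv Y ⟨Z, hZ⟩).symm g).hom
  refine ⟨f', f'.hom.continuous, fun y => ?_⟩
  have h := (r.adj.homEquiv Y ⟨Z, hZ⟩).apply_symm_apply g
  rw [Adjunction.homEquiv_unit] at h
  exact congrArg (fun k : Y ⟶ Z => k y) h

/-- A set is `A`-open if it is the preimage of an open set under a continuous map to a space
in `A`. -/
def IsPreimageOpen (A : ObjectProperty TopCat.{u}) {Y : Type u} [TopologicalSpace Y]
    (W : Set Y) : Prop :=
  ∃ (Z : TopCat.{u}) (f : Y → Z) (V : Set Z), A Z ∧ Continuous f ∧ IsOpen V ∧ f ⁻¹' V = W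

/-- Preimage-open sets are pulled back from the reflection, so the reflection map is inducing; `T₀`
makes it injective, and it is surjective, hence a homeomorphism. -/
theorem IsEpireflective.of_locally_preimageOpen {A : ObjectProperty TopCat.{u}}
    (hA : IsEpireflective A) (Y : TopCat.{u}) [T0Space Y]
    (h : ∀ W : Set Y, IsOpen W → ∀ y ∈ W, ∃ U D : Set Y,
      IsPreimageOpen A U ∧ IsPreimageOpen A D ∧ y ∈ U ∩ D ∧ U ∩ D ⊆ W) : A Y := by
  obtain ⟨R, r, hR, hr, hsurj, hlift⟩ := hA.exists_reflection Y
  have key : ∀ W : Set Y, IsPreimageOpen A W → ∃ V : Set R, IsOpen V ∧ r ⁻¹' V = W := by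
    rintro W ⟨Z, f, V, hZ, hf, hV, rfl⟩
    obtain ⟨f', hf', h'⟩ := hlift Z f hZ hf
    refine ⟨f' ⁻¹' V, hV.preimage hf', ?_⟩
    ext y
    simp [h']
  have hind : IsInducing r := by
    refine isInducing_iff_nhds.2 fun y => le_antisymm ?_ ?_
    · exact (hr.tendsto y).le_comap
    · intro W hW
      obtain ⟨W', hW', hWo, hyW⟩ := mem_nhds_iff.1 hW
      obtain ⟨U, D, hU, hD, hy, hUD⟩ := h W' hWo y hyW
      obtain ⟨U', hU', rfl⟩ := key U hU
      obtain ⟨D', hD', rfl⟩ := key D hD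
      exact Filter.mem_comap.2 ⟨U' ∩ D', (hU'.inter hD').mem_nhds hy, hUD.trans hW'⟩
  have hemb : IsEmbedding r := hind.isEmbedding
  have := hA.1
  exact A.prop_of_iso (TopCat.isoOfHomeo (hemb.toHomeomorphOfSurjective hsurj)).symm hR

theorem IsEpireflective.of_isEmbedding {A : ObjectProperty TopCat.{u}}
    (hA : IsEpireflective A) {Y Z : TopCat.{u}} {i : Y → Z} (hi : IsEmbedding i) (hZ : A Z) :
    A Y := by
  obtain ⟨R, r, hR, hr, hsurj, hlift⟩ := hA.exists_reflection Y
  obtain ⟨i', hi', h⟩ := hlift Z i hZ hi.continuous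
  have hemb : IsEmbedding r := IsEmbedding.of_comp hr hi' (by convert hi using 1; ext y; exact h y)
  have := hA.1
  exact A.prop_of_iso (TopCat.isoOfHomeo (hemb.toHomeomorphOfSurjective hsurj)).symm hR

theorem IsEpireflective.t0Space {A : ObjectProperty TopCat.{u}} (hA : IsEpireflective A)
    (hA2 : ¬ A twoPointIndiscrete) {X : TopCat.{u}} (hX : A X) : T0Space X := by
  refine ⟨fun x y hxy => by_contra fun hne => hA2 ?_⟩
  let f : twoPointIndiscrete.{u} → X := fun b => if (show ULift Bool from b).down then x else y
  have hf : ∀ b c, Inseparable (f b) (f c) := by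
    intro b c
    simp only [f]
    split_ifs
    exacts [.rfl, hxy, hxy.symm, .rfl]
  have hcont : Continuous f := by
    refine continuous_iff_le_induced.2 ?_
    intro s hs
    obtain ⟨O, hO, rfl⟩ := isOpen_induced_iff.1 hs
    refine (TopologicalSpace.isOpen_top_iff _).2 ?_
    by_cases h : f ⟨true⟩ ∈ O
    · exact Or.inr (Set.eq_univ_of_forall fun b => ((hf b _).mem_open_iff hO).2 h)
    · exact Or.inl (Set.eq_empty_of_forall_notMem fun b hb => h (((hf b _).mem_open_iff hO).1 hb))
  refine hA.of_isEmbedding (i := f) ⟨⟨le_antisymm (continuous_iff_le_induced.1 hcont) le_top⟩, ?_⟩ hX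
  rintro ⟨_ | _⟩ ⟨_ | _⟩ h
  · rfl
  · exact absurd h.symm hne
  · exact absurd h hne
  · rfl

/-- An epireflective subcategory consisting of `T₀` spaces either consists of `T₁` spaces or
contains all `T₀` spaces. -/
theorem IsEpireflective.forall_t1Space_or_forall_of_t0Space {A : ObjectProperty TopCat.{u}}
    (hA : IsEpireflective A) (hA2 : ¬ A twoPointIndiscrete) :
    (∀ X : TopCat.{u}, A X → T1Space X) ∨ ∀ X : TopCat.{u}, T0Space X → A X := by
  refine or_iff_not_imp_left.2 fun h Y hY => ?_
  push Not at h
  obtain ⟨P, hP, hP1⟩ := h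
  have := hA.t0Space hA2 hP
  obtain ⟨x, y, hxy, hne⟩ : ∃ x y : P, x ⤳ y ∧ x ≠ y := by
    by_contra! hcon
    exact hP1 (t1Space_iff_specializes_imp_eq.2 fun a b => hcon a b)
  obtain ⟨V, hV, hxV, hyV⟩ : ∃ V : Set P, IsOpen V ∧ x ∈ V ∧ y ∉ V := by
    by_contra! hcon
    exact hne (hxy.antisymm (specializes_iff_forall_open.2 hcon)).eq
  classical
  have key : ∀ W : Set Y, IsOpen W → IsPreimageOpen A W := by
    intro W hW
    -- Since `x ⤳ y`, the pair `x`, `y` acts as a Sierpiński space: every open set containing `y`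
    -- contains `x`.
    refine ⟨P, fun w => if w ∈ W then x else y, V, hP, ⟨fun O hO => ?_⟩, hV, ?_⟩
    · by_cases hyO : y ∈ O
      · convert isOpen_univ
        refine Set.eq_univ_of_forall fun w => ?_
        have := hxy.mem_open hO hyO
        by_cases hw : w ∈ W <;> simp [*]
      · by_cases hxO : x ∈ O
        · convert hW
          ext w
          by_cases hw : w ∈ W <;> simp [*]
        · convert isOpen_empty
          refine Set.eq_empty_of_forall_notMem fun w => ?_
          by_cases hw : w ∈ W <;> simp [*]
    · ext w
      by_cases hw : w ∈ W <;> simp [*]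
  exact hA.of_locally_preimageOpen Y fun W hW y hy =>
    ⟨W, W, key W hW, key W hW, ⟨hy, hy⟩, Set.inter_subset_left⟩

theorem isPreimageOpen_of_isClopen {A : ObjectProperty TopCat.{u}} {P : TopCat.{u}} (hP : A P)
    [T1Space P] [Nontrivial P] {Y : Type u} [TopologicalSpace Y] {D : Set Y} (hD : IsClopen D) :
    IsPreimageOpen A D := by
  classical
  obtain ⟨x, y, hxy⟩ := exists_pair_ne P
  refine ⟨P, fun w => if w ∈ D then x else y, {y}ᶜ, hP, ?_, isOpen_compl_singleton, ?_⟩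
  · refine continuous_const.if (fun a ha => ?_) continuous_const
    have : frontier D = ∅ := hD.frontier_eq
    exact absurd ha (by simp [this])
  · ext w
    by_cases hw : w ∈ D <;> simp [hw, hxy]

/-! ### The coreflective hull as a class of final topologies -/

/-- The topology of `Y` is final with respect to all continuous maps from spaces in `B`. -/
def IsGeneratedByMaps (B : ObjectProperty TopCat.{u}) : ObjectProperty TopCat.{u} := fun Y =>
  ∀ U : Set Y, (∀ (X : TopCat.{u}) (f : X → Y), B X → Continuous f → IsOpen (f ⁻¹' U)) → IsOpen U

/-- The final topology with respect to all continuous maps from spaces in `B`. -/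
@[reducible]
def generatedTopology (B : ObjectProperty TopCat.{u}) (Y : Type u) [TopologicalSpace Y] :
    TopologicalSpace Y where
  IsOpen U := ∀ (X : TopCat.{u}) (f : X → Y), B X → Continuous f → IsOpen (f ⁻¹' U)
  isOpen_univ _ _ _ _ := isOpen_univ
  isOpen_inter U V hU hV X f hX hf := (hU X f hX hf).inter (hV X f hX hf)
  isOpen_sUnion S hS X f hX hf := by
    rw [Set.preimage_sUnion]
    exact isOpen_biUnion fun U hU => hS U hU X f hX hf

/-- The space `Y` retopologized by the final topology from spaces in `B`. -/
def generatedSpace (B : ObjectProperty TopCat.{u}) (Y : TopCat.{u}) : TopCat.{u} :=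
  @TopCat.of Y (generatedTopology B Y)

theorem generatedTopology_le (B : ObjectProperty TopCat.{u}) (Y : Type u) [t : TopologicalSpace Y] :
    generatedTopology B Y ≤ t :=
  fun _ hU _ _ _ hf => hU.preimage hf

theorem isGeneratedByMaps_generatedSpace (B : ObjectProperty TopCat.{u}) (Y : TopCat.{u}) :
    IsGeneratedByMaps B (generatedSpace B Y) := fun _ h X f hX hf =>
  h X f hX ⟨fun _ hV => hV X f hX hf⟩

theorem IsGeneratedByMaps.continuous_generatedSpace {B : ObjectProperty TopCat.{u}} {T Y : TopCat.{u}}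
    (hT : IsGeneratedByMaps B T) {g : T → Y} (hg : Continuous g) :
    Continuous (Y := generatedSpace B Y) g :=
  ⟨fun _ hW => hT _ fun X f hX hf => hW X (g ∘ f) hX (hg.comp hf)⟩

theorem isCoreflectiveSubcat_isGeneratedByMaps (B : ObjectProperty TopCat.{u}) :
    IsCoreflectiveSubcat (IsGeneratedByMaps B) := by
  refine ⟨⟨fun {Y Y'} e hY U h => ?_⟩, ⟨?_⟩⟩
  · let e' := TopCat.homeoOfIso e
    rw [← e'.isOpen_preimage]
    exact hY _ fun X f hX hf => h X (e' ∘ f) hX (e'.continuous.comp hf)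
  · let c (Y : TopCat.{u}) : generatedSpace B Y ⟶ Y :=
      TopCat.ofHom (X := generatedSpace B Y) ⟨id, continuous_id_iff_le.2 (generatedTopology_le B Y)⟩
    let e (T : (IsGeneratedByMaps B).FullSubcategory) (Y : TopCat.{u}) :
        ((IsGeneratedByMaps B).ι.obj T ⟶ Y) ≃
          (T ⟶ ⟨generatedSpace B Y, isGeneratedByMaps_generatedSpace B Y⟩) :=
      { toFun g := ObjectProperty.homMk (TopCat.ofHom (Y := generatedSpace B Y)
          ⟨g, T.property.continuous_generatedSpace g.hom.continuous⟩)
        invFun g := g.hom ≫ c Y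
        left_inv _ := rfl
        right_inv _ := rfl }
    exact
      { R := _
        adj := Adjunction.adjunctionOfEquivRight e fun _ _ _ _ _ => rfl }

/-- For any coreflective `C` containing `B`, the counit at `Y` is a homeomorphism: constant maps
give bijectivity (the point `p` is needed for surjectivity), and finality of the topology gives
openness. -/
theorem coreflectiveHull_iff_isGeneratedByMaps {B : ObjectProperty TopCat.{u}} {P : TopCat.{u}}
    (hP : B P) (p : P) (Y : TopCat.{u}) : coreflectiveHull B Y ↔ IsGeneratedByMaps B Y := by
  refine ⟨fun h => h _ (isCoreflectiveSubcat_isGeneratedByMaps B)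
    fun X hX U hU => hU X id hX continuous_id, ?_⟩
  rintro hY C ⟨hC, ⟨r⟩⟩ hBC
  let T := r.R.obj Y
  let c : T.obj ⟶ Y := r.adj.counit.app Y
  have lift : ∀ (X : TopCat.{u}) (f : X → Y), C X → Continuous f →
      ∃ f' : X → T.obj, Continuous f' ∧ ∀ x, c (f' x) = f x := by
    intro X f hX hf
    let g : C.ι.obj ⟨X, hX⟩ ⟶ Y := TopCat.ofHom ⟨f, hf⟩
    let f' := (r.adj.homEquiv ⟨X, hX⟩ Y g).hom
    refine ⟨f', f'.hom.continuous, fun x => ?_⟩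
    have h := (r.adj.homEquiv ⟨X, hX⟩ Y).symm_apply_apply g
    rw [Adjunction.homEquiv_counit] at h
    exact congrArg (fun k : X ⟶ Y => k x) h
  have hinj : Function.Injective c := by
    intro a b hab
    let k (a : T.obj) : T ⟶ T := ObjectProperty.homMk (TopCat.ofHom (ContinuousMap.const _ a))
    have : k a = k b := by
      apply (r.adj.homEquiv T Y).symm.injective
      rw [Adjunction.homEquiv_counit, Adjunction.homEquiv_counit]
      ext x
      exact hab
    exact congrArg (fun m : T ⟶ T => m.hom a) this
  have hsurj : Function.Surjective c := by
    intro y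
    obtain ⟨f', -, h⟩ := lift P (fun _ => y) (hBC _ hP) continuous_const
    exact ⟨f' p, h p⟩
  have hopen : IsOpenMap c := by
    intro V hV
    refine hY _ fun X f hX hf => ?_
    obtain ⟨f', hf', h⟩ := lift X f (hBC _ hX) hf
    convert hV.preimage hf' using 1
    ext x
    simp only [Set.mem_preimage, ← h]
    exact hinj.mem_set_image
  have := TopCat.isIso_of_bijective_of_isOpenMap c ⟨hinj, hsurj⟩ hopen
  exact C.prop_of_iso (asIso c) T.property

/-! ### Prime spaces -/

/-- `X` has `x` as its only accumulation point. -/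
structure IsPrimeAt (X : Type u) [TopologicalSpace X] (x : X) : Prop where
  not_isOpen : ¬ IsOpen ({x} : Set X)
  isOpen_of_ne : ∀ p, p ≠ x → IsOpen ({p} : Set X)

theorem IsPrimeSpace.exists_isPrimeAt {X : Type u} [TopologicalSpace X] (h : IsPrimeSpace X) :
    ∃ x : X, IsPrimeAt X x := by
  have key : ∀ a : X, AccPt a (Filter.principal Set.univ) ↔ ¬ IsOpen ({a} : Set X) := fun a => by
    rw [isOpen_singleton_iff_punctured_nhds, AccPt, Filter.principal_univ, inf_top_eq,
      Filter.neBot_iff]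
  obtain ⟨a, ha, hu⟩ := h
  exact ⟨a, (key a).1 ha, fun p hp => by_contra fun hno => hp (hu p ((key p).2 hno))⟩

theorem IsPrimeAt.isOpen_of_notMem {X : Type u} [TopologicalSpace X] {x : X} (h : IsPrimeAt X x)
    {W : Set X} (hx : x ∉ W) : IsOpen W := by
  rw [← Set.biUnion_of_singleton W]
  exact isOpen_biUnion fun p hp => h.isOpen_of_ne p (ne_of_mem_of_not_mem hp hx)

theorem IsPrimeAt.exists_ne_mem {X : Type u} [TopologicalSpace X] {x : X} (h : IsPrimeAt X x)
    {W : Set X} (hW : IsOpen W) (hx : x ∈ W) : ∃ p ∈ W, p ≠ x := by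
  by_contra! hcon
  refine h.not_isOpen ?_
  convert hW
  exact (Set.eq_singleton_iff_unique_mem.2 ⟨hx, hcon⟩).symm

/-! ### Gluing prime spaces to points of a space -/

section Glue

/-- The underlying set of the space obtained from `Z` by attaching `X n` to `Z`, identifying
`x n` with `n`, for all `n` in `N`. -/
def Glue (Z : Type u) (N : Set Z) (X : N → Type u) (x : ∀ n, X n) : Type u :=
  Z ⊕ Σ n : N, {p : X n // p ≠ x n}

variable {Z : Type u} {N : Set Z} {X : N → Type u} {x : ∀ n, X n}

namespace Glue

/-- The inclusion of the base. -/
def base (z : Z) : Glue Z N X x := Sum.inl z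

/-- The inclusion of the points of the attached spaces different from the attaching points. -/
def pt (n : N) (p : X n) (hp : p ≠ x n) : Glue Z N X x := Sum.inr ⟨n, p, hp⟩

theorem base_ne_pt (z : Z) (n : N) (p : X n) (hp : p ≠ x n) :
    (base z : Glue Z N X x) ≠ pt n p hp := Sum.inl_ne_inr

open Classical in
/-- The canonical map from an attached space. -/
noncomputable def fib (n : N) (p : X n) : Glue Z N X x :=
  if hp : p = x n then base (n : Z) else pt n p hp

theorem fib_self (n : N) : (fib n (x n) : Glue Z N X x) = base (n : Z) := dif_pos rfl

theorem fib_of_ne {n : N} {p : X n} (hp : p ≠ x n) : (fib n p : Glue Z N X x) = pt n p hp :=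
  dif_neg hp

theorem fib_eq_pt {n m : N} {p : X n} {q : X m} {hq : q ≠ x m}
    (h : (fib n p : Glue Z N X x) = pt m q hq) : (⟨n, p⟩ : Σ n, X n) = ⟨m, q⟩ := by
  by_cases hp : p = x n
  · subst hp
    rw [fib_self] at h
    exact absurd h (base_ne_pt _ _ _ _)
  · rw [fib_of_ne hp] at h
    have := Sum.inr_injective h
    simp only [Sigma.mk.injEq] at this ⊢
    obtain ⟨rfl, h2⟩ := this
    simpa using h2

theorem cases_on {motive : Glue Z N X x → Prop} (base : ∀ z, motive (base z))
    (pt : ∀ n p hp, motive (pt n p hp)) (u : Glue Z N X x) : motive u := by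
  obtain z | ⟨n, p, hp⟩ := u
  exacts [base z, pt n p hp]

/-- The map out of the glued space determined by maps on the pieces. -/
def desc {Y : Type*} (g : Z → Y) (f : ∀ n, X n → Y) : Glue Z N X x → Y :=
  Sum.elim g fun w => f w.1 w.2.1

theorem desc_base {Y : Type*} (g : Z → Y) (f : ∀ n, X n → Y) (z : Z) :
    desc g f (base z : Glue Z N X x) = g z := rfl

theorem desc_pt {Y : Type*} (g : Z → Y) (f : ∀ n, X n → Y) (n : N) (p : X n) (hp : p ≠ x n) :
    desc g f (pt n p hp : Glue Z N X x) = f n p := rfl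

theorem desc_fib {Y : Type*} (g : Z → Y) (f : ∀ n, X n → Y) (h : ∀ n, f n (x n) = g n) (n : N)
    (p : X n) : desc g f (fib n p : Glue Z N X x) = f n p := by
  by_cases hp : p = x n
  · subst hp
    rw [fib_self, desc_base, h]
  · rw [fib_of_ne hp, desc_pt]

variable [TopologicalSpace Z] [∀ n, TopologicalSpace (X n)]

/-- The final topology with respect to the inclusions of the pieces. -/
noncomputable instance : TopologicalSpace (Glue Z N X x) :=
  .coinduced base inferInstance ⊔ ⨆ n, .coinduced (fib n) inferInstance

theorem isOpen_iff {W : Set (Glue Z N X x)} :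
    IsOpen W ↔ IsOpen (base ⁻¹' W) ∧ ∀ n, IsOpen (fib n ⁻¹' W) := by
  refine and_congr isOpen_coinduced ?_
  exact isOpen_iSup_iff.trans (forall_congr' fun _ => isOpen_coinduced)

theorem isOpen_iff_of_isPrimeAt (hX : ∀ n, IsPrimeAt (X n) (x n)) {W : Set (Glue Z N X x)} :
    IsOpen W ↔ IsOpen (base ⁻¹' W) ∧ ∀ n : N, base (n : Z) ∈ W → IsOpen (fib n ⁻¹' W) := by
  rw [isOpen_iff]
  refine and_congr_right fun _ => forall_congr' fun n => ⟨fun h _ => h, fun h => ?_⟩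
  by_cases hn : base (n : Z) ∈ W
  · exact h hn
  · exact (hX n).isOpen_of_notMem (by rwa [Set.mem_preimage, fib_self])

theorem continuous_base : Continuous (base : Z → Glue Z N X x) :=
  ⟨fun _ hW => (isOpen_iff.1 hW).1⟩

theorem continuous_fib (n : N) : Continuous (fib n : X n → Glue Z N X x) :=
  ⟨fun _ hW => (isOpen_iff.1 hW).2 n⟩

theorem continuous_desc {Y : Type*} [TopologicalSpace Y] {g : Z → Y} {f : ∀ n, X n → Y}
    (hg : Continuous g) (hf : ∀ n, Continuous (f n)) (h : ∀ n, f n (x n) = g n) :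
    Continuous (desc g f : Glue Z N X x → Y) := by
  refine ⟨fun O hO => isOpen_iff.2 ⟨hO.preimage hg, fun n => ?_⟩⟩
  convert hO.preimage (hf n) using 1
  ext p
  simp only [Set.mem_preimage, desc_fib g f h]

theorem continuous_retraction : Continuous (desc id fun n _ => n : Glue Z N X x → Z) :=
  continuous_desc continuous_id (fun _ => continuous_const) fun _ => rfl

theorem isOpen_pt (hX : ∀ n, IsPrimeAt (X n) (x n)) (n : N) (p : X n) (hp : p ≠ x n) :
    IsOpen ({pt n p hp} : Set (Glue Z N X x)) := by
  rw [isOpen_iff_of_isPrimeAt hX]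
  refine ⟨?_, fun m hm => absurd hm (base_ne_pt _ _ _ _)⟩
  convert isOpen_empty
  exact Set.eq_empty_of_forall_notMem fun z hz => base_ne_pt z n p hp hz

theorem isClosed_pt [∀ n, T1Space (X n)] (n : N) (p : X n) (hp : p ≠ x n) :
    IsClosed ({pt n p hp} : Set (Glue Z N X x)) := by
  rw [← isOpen_compl_iff, isOpen_iff]
  constructor
  · convert isOpen_univ
    exact Set.eq_univ_of_forall fun z => base_ne_pt z n p hp
  · intro m
    by_cases hm : m = n
    · subst hm
      convert (isOpen_compl_singleton : IsOpen ({p}ᶜ : Set (X m))) using 1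
      ext q
      refine not_congr ⟨fun h => ?_, fun h => ?_⟩
      · simpa using fib_eq_pt (h : fib m q = pt m p hp)
      · obtain rfl : q = p := h
        exact fib_of_ne hp
    · convert isOpen_univ
      exact Set.eq_univ_of_forall fun q hq => hm (congrArg Sigma.fst (fib_eq_pt hq))

theorem t0Space [T0Space Z] (hX : ∀ n, IsPrimeAt (X n) (x n)) : T0Space (Glue Z N X x) := by
  refine ⟨fun u v huv => ?_⟩
  induction u using cases_on with
  | pt n p hp =>
    exact ((huv.mem_open_iff (isOpen_pt hX n p hp)).1 rfl).symm
  | base z =>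
    induction v using cases_on with
    | pt n p hp => exact (huv.mem_open_iff (isOpen_pt hX n p hp)).2 rfl
    | base z' => exact congrArg base (huv.map continuous_retraction).eq

/-- If `A` contains all `T₀` spaces this is immediate. Otherwise its members are `T₁`, and the
topology is generated by clopen sets and preimages of open sets of `Z` under the retraction. -/
theorem mem_of_isEpireflective {A : ObjectProperty TopCat.{u}} (hA : IsEpireflective A)
    (hA2 : ¬ A twoPointIndiscrete) {Z : TopCat.{u}} {N : Set Z} {X : N → TopCat.{u}}
    {x : ∀ n, X n} {P : TopCat.{u}} (hP : A P) [Nontrivial P] (hZ : A Z) (hAX : ∀ n, A (X n))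
    (hX : ∀ n, IsPrimeAt (X n) (x n)) : A (TopCat.of (Glue Z N (fun n => X n) x)) := by
  have := hA.t0Space hA2 hZ
  have hT0 : T0Space (Glue Z N (fun n => X n) x) := t0Space hX
  obtain hT1 | hall := hA.forall_t1Space_or_forall_of_t0Space hA2
  swap
  · exact hall _ hT0
  have := hT1 _ hP
  have := fun n => hT1 _ (hAX n)
  refine hA.of_locally_preimageOpen _ fun W hW u hu => ?_
  induction u using cases_on with
  | pt n p hp =>
    have hclopen : IsClopen ({pt n p hp} : Set (Glue Z N (fun n => X n) x)) :=
      ⟨isClosed_pt (X := fun n => X n) n p hp, isOpen_pt hX n p hp⟩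
    have h := isPreimageOpen_of_isClopen hP hclopen
    exact ⟨_, _, h, h, ⟨rfl, rfl⟩, by rintro _ ⟨rfl, -⟩; exact hu⟩
  | base z =>
    let ret : Glue Z N (fun n => X n) x → Z := desc id fun n _ => n
    let U : Set Z := base ⁻¹' W
    -- `D` agrees with `W` over `U` and is everything elsewhere. It is clopen because its complement
    -- consists of isolated attached points only.
    let D : Set (Glue Z N (fun n => X n) x) := Set.range base ∪ W ∪ (ret ⁻¹' U)ᶜ
    have hDopen : IsOpen D := by
      refine isOpen_iff.2 ⟨?_, fun n => ?_⟩
      · convert isOpen_univ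
        exact Set.eq_univ_of_forall fun z => Or.inl (Or.inl ⟨z, rfl⟩)
      · by_cases hn : (n : Z) ∈ U
        · convert hW.preimage (continuous_fib n) using 1
          refine Set.Subset.antisymm ?_ fun p hp => Or.inl (Or.inr hp)
          rintro p ((⟨z, hz⟩ | h) | h)
          · have hp : p = x n := by
              by_contra hp
              rw [fib_of_ne hp] at hz
              exact base_ne_pt _ _ _ _ hz
            subst hp
            rwa [Set.mem_preimage, fib_self]
          · exact h
          · refine absurd hn ?_
            simpa [ret, desc_fib] using h
        · convert isOpen_univ
          refine Set.eq_univ_of_forall fun p => Or.inr ?_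
          simpa [ret, desc_fib] using hn
    have hDclosed : IsClosed D := by
      rw [← isOpen_compl_iff, isOpen_iff_of_isPrimeAt hX]
      refine ⟨?_, fun n hn => absurd (Or.inl (Or.inl ⟨_, rfl⟩)) hn⟩
      convert isOpen_empty
      exact Set.eq_empty_of_forall_notMem fun z hz => hz (Or.inl (Or.inl ⟨z, rfl⟩))
    refine ⟨ret ⁻¹' U, D, ⟨Z, ret, U, hZ, continuous_retraction, hW.preimage continuous_base, rfl⟩,
      isPreimageOpen_of_isClopen hP ⟨hDclosed, hDopen⟩, ⟨hu, Or.inl (Or.inl ⟨z, rfl⟩)⟩, ?_⟩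
    rintro _ ⟨h1, (⟨z', rfl⟩ | h) | h⟩
    exacts [h1, h, absurd h1 h]

theorem mem_of_isHADClass {A B : ObjectProperty TopCat.{u}} (hA : IsEpireflective A)
    (hA2 : ¬ A twoPointIndiscrete) (hB : IsHADClass A B) {Z : TopCat.{u}} {N : Set Z}
    {X : N → TopCat.{u}} {x : ∀ n, X n} {P : TopCat.{u}} (hP : B P) [Nontrivial P] (hZ : B Z)
    (hBX : ∀ n, B (X n)) (hX : ∀ n, IsPrimeAt (X n) (x n)) :
    B (TopCat.of (Glue Z N (fun n => X n) x)) := by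
  let F : Option N → TopCat.{u} := fun o => o.elim Z X
  let q : (Σ o, F o) → Glue Z N (fun n => X n) x := fun w =>
    match w with
    | ⟨none, z⟩ => base z
    | ⟨some n, p⟩ => fib n p
  have hq : IsQuotientMap q := by
    refine (isQuotientMap_iff _).2 ⟨isCoinducing_iff.2 fun W => ?_, fun u => ?_⟩
    · rw [isOpen_iff, isOpen_sigma_iff]
      exact Option.forall
    · induction u using cases_on with
      | base z => exact ⟨⟨none, z⟩, rfl⟩
      | pt n p hp => exact ⟨⟨some n, p⟩, fib_of_ne hp⟩
  refine hB.divisible (TopCat.of (Σ o, F o)) _ q hq (hB.additive _ F ?_)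
    (mem_of_isEpireflective hA hA2 (hB.le _ hP) (hB.le _ hZ) (fun n => hB.le _ (hBX n)) hX)
  rintro (_ | n)
  exacts [hZ, hBX n]

end Glue

end Glue

/-! ### Prime closure and heredity of the hull -/

/-- The points of `Y` that are limits of `M` along a map from a prime space in `B`. -/
def primeClosure (B : ObjectProperty TopCat.{u}) {Y : Type u} [TopologicalSpace Y] (M : Set Y) :
    Set Y :=
  {a | ∃ (X : TopCat.{u}) (x : X) (f : X → Y),
    B X ∧ IsPrimeAt X x ∧ Continuous f ∧ f x = a ∧ ∀ p, p ≠ x → f p ∈ M}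

theorem isClosed_primeClosure {A B : ObjectProperty TopCat.{u}} (hA : IsEpireflective A)
    (hA2 : ¬ A twoPointIndiscrete) (hB : IsHADClass A B) {P : TopCat.{u}} (hP : B P)
    [Nontrivial P] {Y : TopCat.{u}} (hY : IsGeneratedByMaps B Y) (M : Set Y) :
    IsClosed (primeClosure B M) := by
  refine ⟨hY _ fun Z g hZ hg => ?_⟩
  rw [Set.preimage_compl, isOpen_compl_iff]
  set N : Set Z := g ⁻¹' primeClosure B M with hN
  refine isClosed_of_closure_subset fun z hz => by_contra fun hzN => ?_
  have hex : ∀ n : N, g n ∈ primeClosure B M := fun n => n.2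
  choose X x f hBX hX hf hfx hfM using hex
  let G := Glue Z N (fun n => X n) x
  have hG : B (TopCat.of G) := Glue.mem_of_isHADClass hA hA2 hB hP hZ hBX hX
  -- All base points except `z` are discarded, leaving isolated points that are sent into `M`.
  let S : Set G := insert (Glue.base z) (Set.range Glue.base)ᶜ
  let z' : S := ⟨Glue.base z, Set.mem_insert _ _⟩
  have hS : ∀ w : S, w ≠ z' → ∃ n p, ∃ hp : p ≠ x n, (w : G) = Glue.pt n p hp := by
    rintro ⟨w, hw⟩ hne
    induction w using Glue.cases_on with
    | pt n p hp => exact ⟨n, p, hp, rfl⟩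
    | base y =>
      obtain h | h := hw
      · exact absurd (Subtype.ext h) hne
      · exact absurd ⟨y, rfl⟩ h
  refine hzN ⟨TopCat.of S, z', fun w => Glue.desc g f w.1, hB.hereditary _ hG S, ⟨?_, ?_⟩,
    (Glue.continuous_desc hg hf hfx).comp continuous_subtype_val, rfl, ?_⟩
  · intro hopen
    obtain ⟨W, hW, hWz⟩ := isOpen_induced_iff.1 hopen
    have hzW : z' ∈ Subtype.val ⁻¹' W := hWz ▸ rfl
    -- A neighbourhood of `z` contains some `n` in `N`, hence also a new point of the prime space
    -- attached at `n`.
    obtain ⟨n, hnW, hn⟩ := mem_closure_iff.1 hz _ (hW.preimage Glue.continuous_base) hzW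
    obtain ⟨p, hp, hpx⟩ := (hX ⟨n, hn⟩).exists_ne_mem (hW.preimage (Glue.continuous_fib ⟨n, hn⟩))
      (by rwa [Set.mem_preimage, Glue.fib_self])
    rw [Set.mem_preimage, Glue.fib_of_ne hpx] at hp
    have hpS : Glue.pt ⟨n, hn⟩ p hpx ∈ S := by
      refine Or.inr ?_
      rintro ⟨y, hy⟩
      exact Glue.base_ne_pt _ _ _ _ hy
    have : (⟨_, hpS⟩ : S) ∈ Subtype.val ⁻¹' W := hp
    rw [hWz] at this
    exact Glue.base_ne_pt _ _ _ _ (congrArg Subtype.val this).symm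
  · intro w hw
    obtain ⟨n, p, hp, h⟩ := hS w hw
    refine isOpen_induced_iff.2 ⟨_, Glue.isOpen_pt hX n p hp, ?_⟩
    rw [← h]
    ext v
    exact Subtype.ext_iff.symm
  · intro w hw
    obtain ⟨n, p, hp, h⟩ := hS w hw
    change Glue.desc g f w.1 ∈ M
    rw [h, Glue.desc_pt]
    exact hfM n p hp

theorem theorem4p8 (A B : ObjectProperty TopCat.{u})
    (hA : IsEpireflective A) (hA2 : ¬ A twoPointIndiscrete)
    (hB : IsHADClass A B) (hP : ∃ P : TopCat.{u}, B P ∧ IsPrimeSpace P) :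
    IsHereditary (coreflectiveHull B) := by
  obtain ⟨P, hBP, hPrime⟩ := hP
  obtain ⟨x₀, hx₀⟩ := hPrime.exists_isPrimeAt
  obtain ⟨p₀, -, hp₀⟩ := hx₀.exists_ne_mem isOpen_univ (Set.mem_univ _)
  have : Nontrivial P := ⟨⟨p₀, x₀, hp₀⟩⟩
  intro Y hY S
  rw [coreflectiveHull_iff_isGeneratedByMaps hBP x₀] at hY ⊢
  intro U hU
  let M : Set Y := Subtype.val '' Uᶜ
  have hM : IsClosed (primeClosure B M) := isClosed_primeClosure hA hA2 hB hBP hY M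
  refine isOpen_induced_iff.2 ⟨(primeClosure B M)ᶜ, hM.isOpen_compl, ?_⟩
  ext a
  refine ⟨fun ha => by_contra fun haU => ha ?_, ?_⟩
  · exact ⟨P, x₀, fun _ => a, hBP, hx₀, continuous_const, rfl, fun _ _ => ⟨a, haU, rfl⟩⟩
  · rintro haU ⟨X, x, f, hX, hx, hf, hfx, hfM⟩
    have hfS : ∀ p, f p ∈ S := by
      intro p
      by_cases hp : p = x
      · rw [hp, hfx]
        exact a.2
      · obtain ⟨s, -, hs⟩ := hfM p hp
        exact hs ▸ s.2
    refine hx.not_isOpen ?_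
    convert hU X (fun p => ⟨f p, hfS p⟩) hX (hf.subtype_mk hfS)
    refine (Set.eq_singleton_iff_unique_mem.2 ⟨?_, fun p hp => by_contra fun hpx => ?_⟩).symm
    · rw [Set.mem_preimage]
      convert haU
    · obtain ⟨s, hs, hsp⟩ := hfM p hpx
      obtain rfl : s = ⟨f p, hfS p⟩ := Subtype.ext hsp
      exact hs hp
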